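/- A gauge function is a monotone increasing (i.e. non-decreasing), right continuous function $g:[0,\infty)\to[0,\infty)$. For $A\subset\mathbb{R}$, the Hausdorff measure with gauge function $g$ is $$\mathcal{H}^g(A)=\lim_{\delta\to 0+}\inf\Big\{\sum_{i} g(\operatorname{diam} U_i) : A\subset \bigcup_{i} U_i,\ \operatorname{diam} U_i<\delta\Big\},$$ where the infimum is over countable (finite or infinite) covers of $A$ by non-empty sets $U_i$. A Borel set $B\subset\mathbb{R}$ is measured by a Borel measure $\mu$ on $\mathbb{R}$ if $\mu(B)>0$ and $\mu$ is $\sigma$-finite on $B$, i.e. $B$ is a countable union of Borel sets of finite $\mu$-measure. A Borel measure $\mu$ on $\mathbb{R}$ is translation invariant if $\mu(B+t)=\mu(B)$ for all Borel sets $B\subset\mathbb{R}$ and all $t\in\mathbb{R}$. Theorem. There is a compact set $K\subset\mathbb{R}$ which is measured by some translation invariant Borel measure on $\mathbb{R}$, but which is not measured by any Hausdorff measure; that is, for every gauge function $g$, either $\mathcal{H}^g(K)=0$ or $\mathcal{H}^g$ is not $\sigma$-finite on $K$. -/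

import Mathlib

open MeasureTheory
open scoped NNReal ENNReal

/-- A gauge function: a monotone (non-decreasing), right continuous function `[0,∞) → [0,∞)`.
Neither strict monotonicity nor `g 0 = 0` is required. -/
structure IsGauge (g : ℝ≥0 → ℝ≥0) : Prop where
  monotone : Monotone g
  right_continuous : ∀ x, ContinuousWithinAt g (Set.Ici x) x

/-- The Hausdorff measure `H^g` on the Borel sets of `ℝ`: the limit, as `δ → 0+`, of the infimum of
`∑ g (diam Uᵢ)` over countable covers by sets of diameter at most `δ`, where empty covering sets
contribute `0` (see `MeasureTheory.Measure.mkMetric_apply`). The value assigned here to sets of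
infinite diameter plays no role, because only small `δ` matter. -/
noncomputable def gaugeHausdorff (g : ℝ≥0 → ℝ≥0) : Measure ℝ :=
  Measure.mkMetric fun d : ℝ≥0∞ => (g d.toNNReal : ℝ≥0∞)

/-- The set `B` is measured by `μ`: it is Borel, and `μ` is positive and `σ`-finite on `B`. -/
def IsMeasuredBy (B : Set ℝ) (μ : Measure ℝ) : Prop :=
  MeasurableSet B ∧ 0 < μ B ∧ SigmaFinite (μ.restrict B)

open Cardinal PiNat Set

/-!
The points `φ x` with base `4` digits `x a * x b`, for `x : ℕ → Bool` and `a b : ℕ`, form a Sidon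
set: a nonzero difference `φ x - φ y` determines `x` and `y`. So two distinct translates of an
uncountable compact set `K = φ '' S` share at most one point, and the sum of all translates of an
atomless probability measure on `K` is translation invariant and gives `K` measure `1`.

Moving the first position at which two sequences differ to an earlier place does not decrease the
distance of their images under `φ`. Take for `S` a set of sequences supported sparsely, near the
squares. It is a countable union of pieces such that shifting a piece down by one position keeps it
inside `S`, moves first differences to earlier places, and leaves infinitely many bits free. Filling
these bits in all possible ways gives uncountably many disjoint expanded copies of the piece. If a
Hausdorff measure is `σ`-finite on `K`, then one of these copies is null, and hence so is the piece.
-/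

/-! ### Metric outer measures and translation invariant measures -/

theorem mkMetric_image_le_mkMetric_image {α X Y : Type*} [EMetricSpace X] [MeasurableSpace X]
    [BorelSpace X] [EMetricSpace Y] [MeasurableSpace Y] [BorelSpace Y] {m : ℝ≥0∞ → ℝ≥0∞}
    {r : ℝ≥0∞} (hr : 0 < r) (hm : MonotoneOn m (Iic r)) {u : α → X} {v : α → Y} {s : Set α}
    (h : ∀ a ∈ s, ∀ b ∈ s, edist (v a) (v b) ≤ edist (u a) (u b)) :
    Measure.mkMetric m (v '' s) ≤ Measure.mkMetric m (u '' s) := by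
  rw [Measure.mkMetric_apply, Measure.mkMetric_apply]
  refine iSup₂_le fun δ hδ => le_iSup₂_of_le (min δ r) (lt_min hδ hr) ?_
  refine le_iInf₂ fun t hcover => le_iInf fun hdiam => ?_
  have ediam_le (n : ℕ) : Metric.ediam (v '' (s ∩ u ⁻¹' t n)) ≤ Metric.ediam (t n) := by
    refine Metric.ediam_le ?_
    rintro _ ⟨a, ⟨has, hat⟩, rfl⟩ _ ⟨b, ⟨hbs, hbt⟩, rfl⟩
    exact (h a has b hbs).trans (Metric.edist_le_ediam_of_mem hat hbt)
  have le_r (n : ℕ) : Metric.ediam (t n) ≤ r := (hdiam n).trans (min_le_right δ r)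
  refine iInf₂_le_of_le (fun n => v '' (s ∩ u ⁻¹' t n)) ?_ (iInf_le_of_le
    (fun n => (ediam_le n).trans ((hdiam n).trans (min_le_left δ r)))
    (ENNReal.tsum_le_tsum fun n => iSup_le fun hne => ?_))
  · rw [← image_iUnion, ← inter_iUnion, ← preimage_iUnion]
    exact image_mono fun a ha => ⟨ha, hcover (mem_image_of_mem u ha)⟩
  · have : (t n).Nonempty := by
      obtain ⟨_, a, ⟨-, hat⟩, -⟩ := hne
      exact ⟨u a, hat⟩
    exact le_iSup_of_le this (hm ((ediam_le n).trans (le_r n)) (le_r n) (ediam_le n))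

theorem exists_measure_eq_zero_of_pairwise_disjoint {α ι : Type*} [MeasurableSpace α]
    [Uncountable ι] (μ : Measure α) [SFinite μ] {A : ι → Set α} (hA : ∀ i, MeasurableSet (A i))
    (hdisj : Pairwise (Function.onFun Disjoint A)) : ∃ i, μ (A i) = 0 := by
  by_contra! hpos
  have := Measure.countable_meas_pos_of_disjoint_iUnion (μ := μ) hA hdisj
  exact not_countable_univ (this.mono fun i _ => pos_iff_ne_zero.2 (hpos i))

theorem exists_isProbabilityMeasure_nullSingletonClass {α : Type*} [MeasurableSpace α]
    [StandardBorelSpace α] [Uncountable α] :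
    ∃ ν : Measure α, IsProbabilityMeasure ν ∧ NullSingletonClass ν := by
  let e : ℝ ≃ᵐ α := PolishSpace.measurableEquivOfNotCountable
    (not_countable_iff.2 inferInstance) (not_countable_iff.2 inferInstance)
  have : IsProbabilityMeasure (volume.restrict (Icc (0 : ℝ) 1)) := ⟨by simp⟩
  refine ⟨(volume.restrict (Icc 0 1)).map e,
    Measure.isProbabilityMeasure_map e.measurable.aemeasurable, ⟨fun a => ?_⟩⟩
  rw [e.map_apply]
  exact (subsingleton_singleton.preimage e.injective).measure_zero _

section SumTranslates

variable {G : Type*} [AddGroup G] [MeasurableSpace G] [MeasurableAdd G]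

/-- The sum of all left translates of a measure, in general far from being `σ`-finite. -/
noncomputable def sumTranslates (ν : Measure G) : Measure G :=
  Measure.sum fun t : G => ν.map (t + ·)

theorem isAddLeftInvariant_sumTranslates (ν : Measure G) :
    (sumTranslates ν).IsAddLeftInvariant := by
  refine ⟨fun s => ?_⟩
  rw [sumTranslates, Measure.map_sum (measurable_const_add s).aemeasurable]
  refine Measure.ext fun B hB => ?_
  rw [Measure.sum_apply _ hB, Measure.sum_apply _ hB,
    ← (Equiv.addLeft s).tsum_eq fun t => ν.map (t + ·) B]
  refine tsum_congr fun t => ?_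
  rw [Measure.map_map (measurable_const_add s) (measurable_const_add t)]
  simp only [Function.comp_def, Equiv.coe_addLeft, add_assoc]

theorem exists_isAddLeftInvariant_measure_eq_one [StandardBorelSpace G] {K : Set G}
    (hK : MeasurableSet K) (hunc : ¬ K.Countable)
    (hinter : ∀ t ≠ 0, (K ∩ (t + ·) ⁻¹' K).Countable) :
    ∃ μ : Measure G, μ.IsAddLeftInvariant ∧ μ K = 1 := by
  have := hK.standardBorel
  have : Uncountable K := not_countable_iff.1 hunc
  obtain ⟨ν, _, _⟩ := exists_isProbabilityMeasure_nullSingletonClass (α := K)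
  have translate_apply (t : G) :
      (ν.map Subtype.val).map (t + ·) K = ν (Subtype.val ⁻¹' (K ∩ (t + ·) ⁻¹' K)) := by
    rw [Measure.map_apply (measurable_const_add t) hK,
      Measure.map_apply measurable_subtype_coe (measurable_const_add t hK),
      Subtype.preimage_coe_self_inter]
  refine ⟨sumTranslates (ν.map Subtype.val), isAddLeftInvariant_sumTranslates _, ?_⟩
  rw [sumTranslates, Measure.sum_apply _ hK, tsum_eq_single 0 fun t ht => ?_]
  · simp [Measure.map_apply measurable_subtype_coe hK]
  · rw [translate_apply]
    exact ((hinter t ht).preimage Subtype.val_injective).measure_zero ν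

end SumTranslates

/-! ### Geometry and arithmetic of the Cantor function -/

section CantorFunction

variable {c : ℝ} {n : ℕ}

theorem continuous_cantorFunction (h0 : 0 ≤ c) (h1 : c < 1) : Continuous (cantorFunction c) := by
  refine continuous_tsum (u := fun n => c ^ n) (fun n => ?_)
    (summable_geometric_of_lt_one h0 h1) fun n x => ?_
  · exact (continuous_of_discreteTopology (f := fun b : Bool => cond b (c ^ n) 0)).comp
      (continuous_apply n)
  · cases hx : x n <;> simp [hx, abs_of_nonneg h0, pow_nonneg h0]

theorem cantorFunction_mem_Icc (h0 : 0 ≤ c) (h1 : c < 1) (x : ℕ → Bool) :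
    cantorFunction c x ∈ Icc 0 (1 - c)⁻¹ := by
  refine ⟨tsum_nonneg fun n => cantorFunctionAux_nonneg h0, ?_⟩
  rw [← tsum_geometric_of_lt_one h0 h1]
  refine (summable_cantor_function x h0 h1).tsum_le_tsum (fun n => ?_)
    (summable_geometric_of_lt_one h0 h1)
  cases hx : x n <;> simp [hx, pow_nonneg h0]

theorem abs_cantorFunction_sub_le_of_mem_cylinder (h0 : 0 ≤ c) (h1 : c < 1) {x y : ℕ → Bool}
    (h : y ∈ cylinder x n) : |cantorFunction c x - cantorFunction c y| ≤ c ^ n * (1 - c)⁻¹ := by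
  induction n generalizing x y with
  | zero =>
    obtain ⟨hx₀, hx₁⟩ := cantorFunction_mem_Icc h0 h1 x
    obtain ⟨hy₀, hy₁⟩ := cantorFunction_mem_Icc h0 h1 y
    rw [pow_zero, one_mul]
    exact abs_sub_le_of_nonneg_of_le hx₀ hx₁ hy₀ hy₁
  | succ n ih =>
    rw [cantorFunction_succ x h0 h1, cantorFunction_succ y h0 h1, h 0 n.succ_pos,
      add_sub_add_left_eq_sub, ← mul_sub, abs_mul, abs_of_nonneg h0, pow_succ', mul_assoc]
    gcongr
    exact ih fun i hi => h (i + 1) (Nat.succ_lt_succ hi)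

theorem mul_cantorFunction_mem_Icc (h0 : 0 ≤ c) (h1 : c < 1) (x : ℕ → Bool) :
    c * cantorFunction c x ∈ Icc 0 (c * (1 - c)⁻¹) := by
  obtain ⟨hx₀, hx₁⟩ := cantorFunction_mem_Icc h0 h1 x
  exact ⟨mul_nonneg h0 hx₀, mul_le_mul_of_nonneg_left hx₁ h0⟩

theorem le_abs_cantorFunction_sub_of_zero_ne (h0 : 0 ≤ c) (h1 : c ≤ 1 / 3) {x y : ℕ → Bool}
    (h : x 0 ≠ y 0) : c * (1 - c)⁻¹ ≤ |cantorFunction c x - cantorFunction c y| := by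
  have hc : c < 1 := by linarith
  have tail_le_half : c * (1 - c)⁻¹ ≤ 1 / 2 := by
    rw [mul_inv_le_iff₀ (by linarith)]
    linarith
  rw [cantorFunction_succ x h0 hc, cantorFunction_succ y h0 hc, le_abs]
  obtain ⟨hx₀, hx₁⟩ := mul_cantorFunction_mem_Icc h0 hc fun n => x (n + 1)
  obtain ⟨hy₀, hy₁⟩ := mul_cantorFunction_mem_Icc h0 hc fun n => y (n + 1)
  revert h
  cases x 0 <;> cases y 0 <;> intro h
  · exact absurd rfl h
  · right
    simp only [cond_true, cond_false]
    linarith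
  · left
    simp only [cond_true, cond_false]
    linarith
  · exact absurd rfl h

theorem le_abs_cantorFunction_sub_of_notMem_cylinder (h0 : 0 ≤ c) (h1 : c ≤ 1 / 3)
    {x y : ℕ → Bool} (h : y ∉ cylinder x n) :
    c ^ n * (1 - c)⁻¹ ≤ |cantorFunction c x - cantorFunction c y| := by
  have hc : c < 1 := by linarith
  induction n generalizing x y with
  | zero => simp at h
  | succ n ih =>
    by_cases head : y 0 = x 0
    · have tails : (fun n => y (n + 1)) ∉ cylinder (fun n => x (n + 1)) n := fun ht =>
        h fun i hi => by cases i with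
          | zero => exact head
          | succ i => exact ht i (Nat.lt_of_succ_lt_succ hi)
      rw [cantorFunction_succ x h0 hc, cantorFunction_succ y h0 hc, head,
        add_sub_add_left_eq_sub, ← mul_sub, abs_mul, abs_of_nonneg h0, pow_succ', mul_assoc]
      gcongr
      exact ih tails
    · have : 0 ≤ (1 - c)⁻¹ := inv_nonneg.2 (by linarith)
      calc c ^ (n + 1) * (1 - c)⁻¹
          ≤ c * (1 - c)⁻¹ := by
            gcongr
            exact pow_le_of_le_one h0 hc.le n.succ_ne_zero
        _ ≤ _ := le_abs_cantorFunction_sub_of_zero_ne h0 h1 (Ne.symm head)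

theorem head_and_tail_of_cantorFunction_add_eq (h0 : 0 < c) (h1 : c < 1 / 3)
    {x y x' y' : ℕ → Bool}
    (h : cantorFunction c x + cantorFunction c y = cantorFunction c x' + cantorFunction c y') :
    (x 0).toNat + (y 0).toNat = (x' 0).toNat + (y' 0).toNat ∧
      cantorFunction c (fun n => x (n + 1)) + cantorFunction c (fun n => y (n + 1)) =
        cantorFunction c (fun n => x' (n + 1)) + cantorFunction c (fun n => y' (n + 1)) := by
  have hc : c < 1 := by linarith
  have tail_lt_half : c * (1 - c)⁻¹ < 1 / 2 := by
    rw [mul_inv_lt_iff₀ (by linarith)]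
    linarith
  have tail (z : ℕ → Bool) := mul_cantorFunction_mem_Icc h0.le hc fun n => z (n + 1)
  have cantorFunction_eq (z : ℕ → Bool) :
      cantorFunction c z = (z 0).toNat + c * cantorFunction c fun n => z (n + 1) := by
    rw [cantorFunction_succ z h0.le hc]
    cases z 0 <;> simp
  rw [cantorFunction_eq x, cantorFunction_eq y, cantorFunction_eq x', cantorFunction_eq y'] at h
  have heads : (x 0).toNat + (y 0).toNat = (x' 0).toNat + (y' 0).toNat := by
    have close : |(((x 0).toNat + (y 0).toNat : ℤ) - ((x' 0).toNat + (y' 0).toNat) : ℝ)| < 1 := by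
      push_cast
      rw [abs_lt]
      constructor <;> linarith [(tail x).1, (tail x).2, (tail y).1, (tail y).2, (tail x').1,
        (tail x').2, (tail y').1, (tail y').2]
    have : |((x 0).toNat + (y 0).toNat : ℤ) - ((x' 0).toNat + (y' 0).toNat)| < 1 := by
      exact_mod_cast close
    exact_mod_cast sub_eq_zero.1 (Int.abs_lt_one_iff.1 this)
  have heads_real : ((x 0).toNat + (y 0).toNat : ℝ) = (x' 0).toNat + (y' 0).toNat := by
    exact_mod_cast heads
  exact ⟨heads, mul_left_cancel₀ h0.ne' (by linarith)⟩

theorem toNat_add_toNat_eq_of_cantorFunction_add_eq (h0 : 0 < c) (h1 : c < 1 / 3)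
    {x y x' y' : ℕ → Bool}
    (h : cantorFunction c x + cantorFunction c y = cantorFunction c x' + cantorFunction c y') :
    (x n).toNat + (y n).toNat = (x' n).toNat + (y' n).toNat := by
  induction n generalizing x y x' y' with
  | zero => exact (head_and_tail_of_cantorFunction_add_eq h0 h1 h).1
  | succ _ ih => exact ih (head_and_tail_of_cantorFunction_add_eq h0 h1 h).2

end CantorFunction

/-! ### An embedding of the Cantor space with distinct differences -/

/-- All pairwise products of the bits of `x`, those of the first `k` bits coming first. The bits
themselves are the products with equal factors. -/
def pairProducts (x : ℕ → Bool) : ℕ → Bool :=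
  fun n => x n.unpair.1 && x n.unpair.2

theorem pairProducts_pair (x : ℕ → Bool) (a b : ℕ) :
    pairProducts x (Nat.pair a b) = (x a && x b) := by
  simp [pairProducts]

theorem pairProducts_mem_cylinder_sq_iff {x y : ℕ → Bool} {k : ℕ} :
    pairProducts y ∈ cylinder (pairProducts x) (k ^ 2) ↔ y ∈ cylinder x k := by
  constructor
  · intro h i hi
    have := h (Nat.pair i i) ((Nat.pair_lt_max_add_one_sq i i).trans_le
      (Nat.pow_le_pow_left (by simpa using hi) 2))
    simpa [pairProducts_pair] using this
  · intro h n hn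
    have hmax : max n.unpair.1 n.unpair.2 < k := by
      refine lt_of_pow_lt_pow_left₀ 2 k.zero_le (lt_of_le_of_lt ?_ hn)
      simpa using le_of_add_le_left (Nat.max_sq_add_min_le_pair n.unpair.1 n.unpair.2)
    rw [max_lt_iff] at hmax
    rw [pairProducts, pairProducts, h _ hmax.1, h _ hmax.2]

/-- The point of the line with base `4` digits `pairProducts x`. No carries occur when two such
points are added, so that the digits of the summands can be compared. -/
noncomputable def sidonEmbedding (x : ℕ → Bool) : ℝ :=
  cantorFunction (1 / 4) (pairProducts x)

theorem continuous_sidonEmbedding : Continuous sidonEmbedding :=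
  (continuous_cantorFunction (by norm_num) (by norm_num)).comp
    (by unfold pairProducts; fun_prop)

theorem sidonEmbedding_injective : Function.Injective sidonEmbedding := by
  intro x y h
  have h := cantorFunction_injective (by norm_num) (by norm_num) h
  funext k
  simpa [pairProducts_pair] using congrFun h (Nat.pair k k)

theorem abs_sidonEmbedding_sub_le_of_mem_cylinder {x y x' y' : ℕ → Bool} {k : ℕ}
    (h : y ∈ cylinder x k) (h' : y' ∉ cylinder x' k) :
    |sidonEmbedding x - sidonEmbedding y| ≤ |sidonEmbedding x' - sidonEmbedding y'| :=
  (abs_cantorFunction_sub_le_of_mem_cylinder (by norm_num) (by norm_num)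
    (pairProducts_mem_cylinder_sq_iff.2 h)).trans
  (le_abs_cantorFunction_sub_of_notMem_cylinder (by norm_num) (by norm_num)
    (mt pairProducts_mem_cylinder_sq_iff.1 h'))

theorem eq_of_sidonEmbedding_add_eq {x y x' y' : ℕ → Bool} (hne : x ≠ y)
    (h : sidonEmbedding x + sidonEmbedding y' = sidonEmbedding x' + sidonEmbedding y) :
    x = x' := by
  have products_eq (a b : ℕ) :
      (x a && x b).toNat + (y' a && y' b).toNat = (x' a && x' b).toNat + (y a && y b).toNat := by
    simpa only [pairProducts_pair] using
      toNat_add_toNat_eq_of_cantorFunction_add_eq (n := Nat.pair a b) (by norm_num) (by norm_num) h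
  obtain ⟨k, hk⟩ := Function.ne_iff.1 hne
  funext b
  have hkk := products_eq k k
  have hkb := products_eq k b
  have hbb := products_eq b b
  revert hk hkk hkb hbb
  generalize x k = p, y k = q, x' k = p', y' k = q', x b = s, y b = t, x' b = s', y' b = t'
  revert p q p' q' s t s' t'
  decide

/-! ### Sequences supported near squares -/

/-- The numbers at most `n` below a square. -/
def nearSquares (n : ℕ) : Set ℕ :=
  {k | ∃ d ≤ n, IsSquare (k + d)}

theorem nearSquares_mono : Monotone nearSquares :=
  fun _ _ hmn _ ⟨d, hd, hk⟩ => ⟨d, hd.trans hmn, hk⟩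

theorem mem_nearSquares_succ {n k : ℕ} (h : k + 1 ∈ nearSquares n) : k ∈ nearSquares (n + 1) := by
  obtain ⟨d, hd, hk⟩ := h
  exact ⟨d + 1, by lia, by rwa [show k + (d + 1) = k + 1 + d by ring]⟩

theorem sq_add_one_notMem_nearSquares {n i : ℕ} (h : n < i) : i ^ 2 + 1 ∉ nearSquares n := by
  rintro ⟨d, hd, j, hj⟩
  have : i < j := by nlinarith
  nlinarith

/-- The subsets of `ℕ`, as bit sequences, all of whose elements lie at most `j` below a square for
every element `j`. By monotonicity of `nearSquares` only the least element `j` matters. -/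
def nearSquareSeqs : Set (ℕ → Bool) :=
  {x | ∀ j k, x j = true → x k = true → k ∈ nearSquares j}

/-- The sequences whose set bits lie at positions at least `n` and at most `n` below a square. A
nonzero sequence in `nearSquareSeqs` lies in `nearSquareStage n` for its first set position `n`. -/
def nearSquareStage (n : ℕ) : Set (ℕ → Bool) :=
  {x | ∀ k, x k = true → n ≤ k ∧ k ∈ nearSquares n}

/-- The part of `nearSquareStage n` on which the bits at `n` and `n + 1` are prescribed by `p`.
These are the only bits of a sequence in `nearSquareStage n` that `graft n w` forgets. -/
def nearSquareCell (n : ℕ) (p : Bool × Bool) : Set (ℕ → Bool) :=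
  {x ∈ nearSquareStage n | (x n, x (n + 1)) = p}

theorem nearSquareStage_subset (n : ℕ) : nearSquareStage n ⊆ nearSquareSeqs :=
  fun _ hx j k hj hk => nearSquares_mono (hx j hj).1 (hx k hk).2

theorem nearSquareSeqs_subset_iUnion_nearSquareCell :
    nearSquareSeqs ⊆ ⋃ n, ⋃ p, nearSquareCell n p := by
  classical
  intro x hx
  suffices ∃ n, x ∈ nearSquareStage n by
    obtain ⟨n, hn⟩ := this
    exact mem_iUnion₂.2 ⟨n, _, hn, rfl⟩
  by_cases hex : ∃ k, x k = true
  · exact ⟨Nat.find hex, fun k hk => ⟨Nat.find_min' hex hk, hx _ k (Nat.find_spec hex) hk⟩⟩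
  · exact ⟨0, fun k hk => absurd ⟨k, hk⟩ hex⟩

theorem isClosed_nearSquareSeqs : IsClosed nearSquareSeqs := by
  simp only [nearSquareSeqs, ofPred_forall]
  refine isClosed_iInter fun j => isClosed_iInter fun k => ?_
  exact (isClosed_discrete {b : Bool × Bool | b.1 → b.2 → k ∈ nearSquares j}).preimage
    (f := fun x : ℕ → Bool => (x j, x k)) (by fun_prop)

theorem isClosed_nearSquareCell (n : ℕ) (p : Bool × Bool) : IsClosed (nearSquareCell n p) := by
  refine IsClosed.inter (s₁ := nearSquareStage n) ?_ (isClosed_eq (by fun_prop) continuous_const)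
  simp only [nearSquareStage, ofPred_forall]
  refine isClosed_iInter fun k => ?_
  exact (isClosed_discrete {b : Bool | b → n ≤ k ∧ k ∈ nearSquares n}).preimage
    (f := fun x : ℕ → Bool => x k) (by fun_prop)

/-- Shift `x` down by one position, clear the bits at positions at most `n`, and write `w` on the
squares `(n + 1) ^ 2, (n + 2) ^ 2, …`. The bits overwritten by `w` sit directly above these squares
in `x`, and are not set when `x` is in `nearSquareStage n`. -/
def graft (n : ℕ) (w x : ℕ → Bool) : ℕ → Bool := fun k =>
  if IsSquare k ∧ n < k.sqrt then w (k.sqrt - (n + 1)) else decide (n < k) && x (k + 1)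

theorem continuous_graft (n : ℕ) (w : ℕ → Bool) : Continuous (graft n w) := by
  refine continuous_pi fun k => ?_
  unfold graft
  split_ifs <;> fun_prop

theorem graft_sq (n : ℕ) (w x : ℕ → Bool) (j : ℕ) : graft n w x ((n + 1 + j) ^ 2) = w j := by
  have hsqrt : ((n + 1 + j) ^ 2).sqrt = n + 1 + j := Nat.sqrt_eq' _
  rw [graft, if_pos ⟨IsSquare.sq _, by lia⟩, hsqrt, Nat.add_sub_cancel_left]

theorem graft_mem_nearSquareStage {n : ℕ} {x : ℕ → Bool} (w : ℕ → Bool)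
    (hx : x ∈ nearSquareStage n) :
    graft n w x ∈ nearSquareStage (n + 1) := by
  intro k hk
  unfold graft at hk
  split_ifs at hk with hsq
  · exact ⟨hsq.2.trans_le (Nat.sqrt_le_self k), 0, Nat.zero_le _, hsq.1⟩
  · rw [Bool.and_eq_true, decide_eq_true_iff] at hk
    exact ⟨hk.1, mem_nearSquares_succ (hx _ hk.2).2⟩

theorem eq_of_graft_eq {n : ℕ} {w w' x x' : ℕ → Bool} (h : graft n w x = graft n w' x') :
    w = w' := by
  funext j
  rw [← graft_sq n w x, h, graft_sq]

theorem exists_mem_cylinder_and_graft_notMem_cylinder {n : ℕ} {p : Bool × Bool} {x y : ℕ → Bool}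
    (w : ℕ → Bool) (hx : x ∈ nearSquareCell n p) (hy : y ∈ nearSquareCell n p) (hne : x ≠ y) :
    ∃ k, y ∈ cylinder x k ∧ graft n w y ∉ cylinder (graft n w x) k := by
  refine ⟨firstDiff x y, (mem_cylinder_comm _ _ _).1 (mem_cylinder_firstDiff x y), ?_⟩
  have hdiff := apply_firstDiff_ne hne
  generalize firstDiff x y = k at hdiff ⊢
  have true_of_ne : x k = true ∨ y k = true := by
    revert hdiff
    cases x k <;> cases y k <;> simp
  have hlt : n + 1 < k := by
    obtain ⟨hn, hn'⟩ := Prod.ext_iff.1 (hx.2.trans hy.2.symm)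
    have hle : n ≤ k := true_of_ne.elim (fun h => (hx.1 k h).1) fun h => (hy.1 k h).1
    have ne_n : k ≠ n := by
      rintro rfl
      exact hdiff hn
    have ne_succ : k ≠ n + 1 := by
      rintro rfl
      exact hdiff hn'
    lia
  have hnear : k ∈ nearSquares n := true_of_ne.elim (fun h => (hx.1 k h).2) fun h => (hy.1 k h).2
  obtain ⟨i, rfl⟩ : ∃ i, k = i + 1 := Nat.exists_eq_succ_of_ne_zero (by lia)
  have not_fresh : ¬(IsSquare i ∧ n < i.sqrt) := by
    rintro ⟨⟨j, rfl⟩, hj⟩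
    rw [Nat.sqrt_eq] at hj
    exact sq_add_one_notMem_nearSquares hj (by rwa [sq])
  intro h
  have := h i i.lt_succ_self
  simp only [graft, if_neg not_fresh, show n < i by lia, decide_true, Bool.true_and] at this
  exact hdiff this.symm

theorem uncountable_nat_bool : Uncountable (ℕ → Bool) := by
  rw [← aleph0_lt_mk_iff]
  simpa using cantor ℵ₀

theorem mkMetric_image_nearSquareSeqs_eq_zero {m : ℝ≥0∞ → ℝ≥0∞} {r : ℝ≥0∞} (hr : 0 < r)
    (hm : MonotoneOn m (Iic r))
    [SigmaFinite ((Measure.mkMetric m).restrict (sidonEmbedding '' nearSquareSeqs))] :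
    Measure.mkMetric m (sidonEmbedding '' nearSquareSeqs) = 0 := by
  refine measure_mono_null (image_mono nearSquareSeqs_subset_iUnion_nearSquareCell) ?_
  simp only [image_iUnion, measure_iUnion_null_iff]
  intro n p
  have := uncountable_nat_bool
  let A (w : ℕ → Bool) : Set ℝ := (sidonEmbedding ∘ graft n w) '' nearSquareCell n p
  have hA (w : ℕ → Bool) : MeasurableSet (A w) := ((isClosed_nearSquareCell n p).isCompact.image
    (continuous_sidonEmbedding.comp (continuous_graft n w))).measurableSet
  have hsub (w : ℕ → Bool) : A w ⊆ sidonEmbedding '' nearSquareSeqs := by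
    rintro _ ⟨x, hx, rfl⟩
    exact mem_image_of_mem _ (nearSquareStage_subset _ (graft_mem_nearSquareStage w hx.1))
  have hdisj : Pairwise (Function.onFun Disjoint A) := by
    refine fun w w' hww' => Set.disjoint_left.2 ?_
    rintro _ ⟨x, -, rfl⟩ ⟨x', -, h⟩
    exact hww' (eq_of_graft_eq (sidonEmbedding_injective h)).symm
  obtain ⟨w, hw⟩ := exists_measure_eq_zero_of_pairwise_disjoint
    ((Measure.mkMetric m).restrict (sidonEmbedding '' nearSquareSeqs)) hA hdisj
  rw [Measure.restrict_eq_self _ (hsub w)] at hw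
  refine le_zero_iff.1 ((mkMetric_image_le_mkMetric_image hr hm fun x hx y hy => ?_).trans_eq hw)
  rcases eq_or_ne x y with rfl | hne
  · simp
  obtain ⟨k, hk, hk'⟩ := exists_mem_cylinder_and_graft_notMem_cylinder w hx hy hne
  simpa only [Function.comp_apply, edist_dist, Real.dist_eq] using
    ENNReal.ofReal_le_ofReal (abs_sidonEmbedding_sub_le_of_mem_cylinder hk hk')

theorem not_countable_image_nearSquareSeqs : ¬ (sidonEmbedding '' nearSquareSeqs).Countable := by
  have := uncountable_nat_bool
  intro hc
  have hzero : (fun _ => false) ∈ nearSquareStage 0 := by simp [nearSquareStage]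
  have hinj : Function.Injective fun w => sidonEmbedding (graft 0 w fun _ => false) :=
    fun w w' h => eq_of_graft_eq (sidonEmbedding_injective h)
  refine not_countable_univ ((hc.preimage hinj).mono fun w _ => ?_)
  exact mem_image_of_mem _ (nearSquareStage_subset _ (graft_mem_nearSquareStage w hzero))

theorem subsingleton_image_inter_translate (S : Set (ℕ → Bool)) {t : ℝ} (ht : t ≠ 0) :
    (sidonEmbedding '' S ∩ (t + ·) ⁻¹' (sidonEmbedding '' S)).Subsingleton := by
  rintro _ ⟨⟨x, -, rfl⟩, y, -, hy⟩ _ ⟨⟨x', -, rfl⟩, y', -, hy'⟩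
  simp only at hy hy'
  have hne : x ≠ y := by
    rintro rfl
    exact ht (by linarith)
  rw [eq_of_sidonEmbedding_add_eq (x' := x') (y' := y') hne (by linarith)]

theorem theorem4p4_general :
    ∃ K : Set ℝ, IsCompact K ∧
      (∃ μ : Measure ℝ, μ.IsAddLeftInvariant ∧ IsMeasuredBy K μ) ∧
      ∀ (m : ℝ≥0∞ → ℝ≥0∞) (r : ℝ≥0∞), 0 < r → MonotoneOn m (Iic r) →
        ¬ IsMeasuredBy K (Measure.mkMetric m) := by
  have hK : IsCompact (sidonEmbedding '' nearSquareSeqs) :=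
    isClosed_nearSquareSeqs.isCompact.image continuous_sidonEmbedding
  obtain ⟨μ, hinv, hone⟩ := exists_isAddLeftInvariant_measure_eq_one hK.measurableSet
    not_countable_image_nearSquareSeqs
    fun t ht => (subsingleton_image_inter_translate _ ht).countable
  have : IsFiniteMeasure (μ.restrict (sidonEmbedding '' nearSquareSeqs)) := ⟨by simp [hone]⟩
  refine ⟨_, hK, ⟨μ, hinv, hK.measurableSet, by simp [hone], inferInstance⟩, ?_⟩
  rintro m r hr hm ⟨-, hpos, _⟩
  exact hpos.ne' (mkMetric_image_nearSquareSeqs_eq_zero hr hm)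

theorem theorem4p4 :
    ∃ K : Set ℝ, IsCompact K ∧
      (∃ μ : Measure ℝ, μ.IsAddLeftInvariant ∧ IsMeasuredBy K μ) ∧
      ∀ g : ℝ≥0 → ℝ≥0, IsGauge g → ¬ IsMeasuredBy K (gaugeHausdorff g) := by
  obtain ⟨K, hK, hμ, hnot⟩ := theorem4p4_general
  refine ⟨K, hK, hμ, fun g hg => hnot _ 1 one_pos fun d _ e he hde => ?_⟩
  have he_top : e ≠ ⊤ := ne_top_of_le_ne_top ENNReal.one_ne_top he
  exact ENNReal.coe_le_coe.2 (hg.monotone (ENNReal.toNNReal_mono he_top hde))
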